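/- Let $\mathfrak{l}\neq 0$ be a nilpotent Lie algebra over $\mathbb{C}$ with $\dim\mathfrak{l}\le 5$. Then $\mathfrak{l}$ can be realized by a central extension of a family of pseudo-bosonic operators, in the following sense. There are an integer $m\ge 1$, a complex Hilbert space $\mathcal{H}$ and a family of $m$ modes of pseudo-bosonic operators $a_1,b_1,\dots,a_m,b_m$ on $\mathcal{H}$ such that 1. there is a central extension $0\to\mathfrak{a}\to\mathfrak{l}\to\mathfrak{b}\to 0$ of Lie algebras over $\mathbb{C}$ (a short exact sequence in which the image of the abelian Lie algebra $\mathfrak{a}$ lies in the center of $\mathfrak{l}$) such that $\dim\mathfrak{a}=1$ and $\mathfrak{b}$ is realized by the family; 2. $\mathfrak{l}$ itself is realized by the family. Here a family of $m$ modes of pseudo-bosonic operators on $\mathcal{H}$ consists of a dense subspace $\mathcal{D}\subseteq\mathcal{H}$ and operators $a_j,b_j$ ($1\le j\le m$) such that $\mathcal{D}$ is contained in the domains of $a_j,b_j,a_j^\dagger,b_j^\dagger$ and invariant under these four operators, and such that, on $\mathcal{D}$, $$[a_j,b_k]=\delta_{jk}\mathbb{I},\qquad [a_j,a_k]=[b_j,b_k]=0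 ;$$ moreover there are vectors $\varphi_0,\Psi_0\in\mathcal{D}$ with $a_j\varphi_0=0$ and $b_j^\dagger\Psi_0=0$ for all $j$ and $\langle\varphi_0,\Psi_0\rangle=1$, such that each of the two families $$\varphi_n=\frac{b_1^{n_1}\cdots b_m^{n_m}\varphi_0}{\sqrt{n_1!\cdots n_m!}},\qquad \Psi_n=\frac{(a_1^\dagger)^{n_1}\cdots (a_m^\dagger)^{n_m}\Psi_0}{\sqrt{n_1!\cdots n_m!}}\qquad (n\in\mathbb{N}_0^m)$$ is a Riesz basis of $\mathcal{H}$. Bosonic operators are the special case $b_j=a_j^\dagger$ on $\mathcal{D}$. A Lie algebra is realized by the family if it is isomorphic to a Lie algebra, under the commutator $[x,y]=xy-yx$, of operators on $\mathcal{D}$ that are polynomials in $a_1,b_1,\dots,a_m,b_m$ (the identity $\mathbb{I}$ being the constant polynomial $1$). -/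

import Mathlib

/-- `m` modes of pseudo-bosonic operators `(a j, b j)` on a complex inner product space `H`.
All operators are considered on a common dense subspace `D`, which is invariant under
`a j`, `b j` and their adjoints: `aAdj j` and `bAdj j` are the restrictions to `D` of the adjoints
of the densely defined operators `a j` and `b j` (by density of `D` they are determined by
`a j` and `b j`). The commutation rules are required on `D`. No relation between `b j` and the
adjoint of `a j` is required; bosons are the special case `b j = aAdj j`. -/
structure PseudoBosonicFamily (m : ℕ) (H : Type) [NormedAddCommGroup H]
    [InnerProductSpace ℂ H] where
  /-- the common invariant domain -/
  D : Submodule ℂ H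
  dense_D : Dense (D : Set H)
  /-- the lowering operators -/
  a : Fin m → Module.End ℂ D
  /-- the raising operators -/
  b : Fin m → Module.End ℂ D
  /-- the adjoints of the lowering operators, on `D` -/
  aAdj : Fin m → Module.End ℂ D
  /-- the adjoints of the raising operators, on `D` -/
  bAdj : Fin m → Module.End ℂ D
  inner_aAdj : ∀ (j : Fin m) (f g : D),
    inner ℂ ((aAdj j f : D) : H) (g : H) = inner ℂ (f : H) ((a j g : D) : H)
  inner_bAdj : ∀ (j : Fin m) (f g : D),
    inner ℂ ((bAdj j f : D) : H) (g : H) = inner ℂ (f : H) ((b j g : D) : H)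
  comm_a_b : ∀ j k : Fin m, a j * b k - b k * a j = if j = k then 1 else 0
  comm_a_a : ∀ j k : Fin m, a j * a k = a k * a j
  comm_b_b : ∀ j k : Fin m, b j * b k = b k * b j

/-- A Riesz basis: the image of an orthonormal (Hilbert) basis under a bounded linear operator
with bounded inverse. -/
def IsRieszBasis {ι H : Type} [NormedAddCommGroup H] [InnerProductSpace ℂ H]
    (f : ι → H) : Prop :=
  ∃ (e : HilbertBasis ι ℂ H) (T : H ≃L[ℂ] H), ∀ i, f i = T (e i)

namespace PseudoBosonicFamily

variable {m : ℕ} {H : Type} [NormedAddCommGroup H] [InnerProductSpace ℂ H]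

/-- Excited states: `c₁ ^ n₁ ⋯ c_m ^ n_m v / √(n₁! ⋯ n_m!)`, for raising operators `c` on `D`
and a vacuum vector `v`. -/
noncomputable def excited {D : Submodule ℂ H} (c : Fin m → Module.End ℂ D) (v : D)
    (n : Fin m → ℕ) : D :=
  ((Real.sqrt ((∏ j, (n j).factorial : ℕ) : ℝ) : ℂ))⁻¹ •
    ((List.ofFn fun j => c j ^ n j).prod v)

/-- The standing assumptions on pseudo-bosons: there is a vacuum `φ₀ ∈ D` annihilated by all
`a j`, a vacuum `Ψ₀ ∈ D` annihilated by all adjoints of the `b j` (normalised by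
`⟨φ₀, Ψ₀⟩ = 1`, so both are non-zero), and the two families of excited states, obtained with
the `b j` from `φ₀` and with the adjoints of the `a j` from `Ψ₀`, are Riesz bases of `H`. -/
def HasRieszVacua (F : PseudoBosonicFamily m H) : Prop :=
  ∃ φ₀ Ψ₀ : F.D,
    (∀ j, F.a j φ₀ = 0) ∧
    (∀ j, F.bAdj j Ψ₀ = 0) ∧
    inner ℂ (φ₀ : H) (Ψ₀ : H) = 1 ∧
    IsRieszBasis (fun n : Fin m → ℕ => ((excited F.b φ₀ n : F.D) : H)) ∧
    IsRieszBasis (fun n : Fin m → ℕ => ((excited F.aAdj Ψ₀ n : F.D) : H))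

/-- The associative algebra of operators on `D` that are polynomials in the operators
`a j`, `b j` (with the identity as constant term). -/
def operatorAlgebra (F : PseudoBosonicFamily m H) : Subalgebra ℂ (Module.End ℂ F.D) :=
  Algebra.adjoin ℂ (Set.range F.a ∪ Set.range F.b)

/-- The Lie algebra `L` is realized by the family `F`: it is isomorphic to a Lie algebra, under the
commutator `x y - y x`, of polynomials in the operators `a j`, `b j`. -/
def Realizes (F : PseudoBosonicFamily m H) (L : Type*) [LieRing L] [LieAlgebra ℂ L] : Prop :=
  ∃ ρ : L →ₗ[ℂ] Module.End ℂ F.D,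
    (∀ x y : L, ρ ⁅x, y⁆ = ρ x * ρ y - ρ y * ρ x) ∧
    Function.Injective ρ ∧ ∀ x, ρ x ∈ F.operatorAlgebra

end PseudoBosonicFamily

/-- `0 → A → L → B → 0` is a central extension of the abelian Lie algebra `A` by `B`. -/
def IsCentralExtension {A L B : Type*} [LieRing A] [LieAlgebra ℂ A] [LieRing L] [LieAlgebra ℂ L]
    [LieRing B] [LieAlgebra ℂ B] (μ : A →ₗ⁅ℂ⁆ L) (ε : L →ₗ⁅ℂ⁆ B) : Prop :=
  IsLieAbelian A ∧ LieAlgebra.IsExtension μ ε ∧ ∀ x : A, μ x ∈ LieAlgebra.center ℂ L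

/-- `L` is realized by a central extension of a family of pseudo-bosonic operators: for some family
of pseudo-bosons on a Hilbert space, `L` is a central extension of a one-dimensional Lie algebra
by a Lie algebra which the family realizes, and the family also realizes `L` itself. -/
def RealizedByPseudoBosonicCentralExtension.{u} (L : Type u) [LieRing L] [LieAlgebra ℂ L] : Prop :=
  ∃ (m : ℕ) (H : Type) (_ : NormedAddCommGroup H) (_ : InnerProductSpace ℂ H)
    (_ : CompleteSpace H) (F : PseudoBosonicFamily m H),
    0 < m ∧ F.HasRieszVacua ∧
    (∃ (A B : Type u) (_ : LieRing A) (_ : LieAlgebra ℂ A) (_ : LieRing B) (_ : LieAlgebra ℂ B)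
      (μ : A →ₗ⁅ℂ⁆ L) (ε : L →ₗ⁅ℂ⁆ B),
      Module.finrank ℂ A = 1 ∧ IsCentralExtension μ ε ∧ F.Realizes B) ∧
    F.Realizes L

/-! The dimension bound only fixes the number of modes. A nilpotent L with dim L ≤ m embeds into any
nontrivial algebra containing m pairs with the canonical commutation relations
(`exists_embedding_of_ccr`), by induction on m. Since [L, L] ≠ L, some hyperplane I contains [L, L];
it is an ideal, and L = I ⊕ ℂx. Let ρ embed I by means of m - 1 pairs, and let a, b be the remaining
pair, which commutes with ρ(I). Send x to a and y ∈ I to ∑ bⁿ/n! · ρ((ad x)ⁿ y), a finite sum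
because ad x is nilpotent. Brackets in I are preserved because exp (t ad x) respects them, and [a,
·] acts as d/db, which reproduces ad x (`exists_embedding_of_ideal_embedding`).

Ordinary bosons suffice as the family: in the Fock representation on polynomials (`fockFamily`) both
families of excited states are the same orthonormal basis. Finally, the center of L contains a line,
and the quotient by it is again nilpotent of dimension at most 5, so the same five modes realize
both L and the quotient. -/

/-- The generating polynomial `∑ tⁿ/n! • ρ (Aⁿ y)` of `ρ ∘ exp (t A)`, for nilpotent `A`. -/
noncomputable def expPolynomial {V S : Type*} [AddCommGroup V] [Module ℂ V] [Ring S] [Algebra ℂ S]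
    (ρ : V →ₗ[ℂ] S) (A : Module.End ℂ V) (N : ℕ) : V →ₗ[ℂ] Polynomial S :=
  ∑ n ∈ Finset.range N,
    ((n.factorial : ℂ)⁻¹) • ((Polynomial.monomial n).restrictScalars ℂ ∘ₗ ρ ∘ₗ (A ^ n))

/-! ### Exponential of a nilpotent derivation -/

section ExpPolynomial

variable {V S : Type*} [AddCommGroup V] [Module ℂ V] [Ring S] [Algebra ℂ S]

lemma coeff_expPolynomial (ρ : V →ₗ[ℂ] S) {A : Module.End ℂ V} {N : ℕ} (hA : A ^ N = 0)
    (y : V) (n : ℕ) :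
    (expPolynomial ρ A N y).coeff n = ((n.factorial : ℂ)⁻¹) • ρ ((A ^ n) y) := by
  simp only [expPolynomial, LinearMap.sum_apply, LinearMap.smul_apply, LinearMap.comp_apply,
    LinearMap.restrictScalars_apply, Polynomial.finsetSum_coeff, Polynomial.coeff_smul,
    Polynomial.coeff_monomial]
  by_cases h : n < N
  · rw [Finset.sum_eq_single n] <;> simp +contextual [h]
  · rw [Finset.sum_eq_zero, pow_eq_zero_of_le (not_lt.1 h) hA]
    · simp
    · intro i hi
      rw [if_neg, smul_zero]
      rintro rfl
      exact h (Finset.mem_range.1 hi)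

/-- This is d/dt exp (tA) = exp (tA) A. The truncation at N is harmless: the one term missing on the
left contains A ^ N = 0. -/
lemma derivative_expPolynomial (ρ : V →ₗ[ℂ] S) {A : Module.End ℂ V} {N : ℕ} (hA : A ^ N = 0)
    (y : V) :
    Polynomial.derivative (expPolynomial ρ A N y) = expPolynomial ρ A N (A y) := by
  ext n
  have h : ((n.factorial : ℂ)) ≠ 0 := by exact_mod_cast n.factorial_ne_zero
  have h' : (n + 1 : ℂ) ≠ 0 := by exact_mod_cast n.succ_ne_zero
  have hc : ((n : S) + 1) = algebraMap ℂ S (n + 1) := by simp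
  rw [Polynomial.coeff_derivative, coeff_expPolynomial ρ hA, coeff_expPolynomial ρ hA, hc,
    ← Algebra.commutes, ← Algebra.smul_def, smul_smul, pow_succ, Module.End.mul_apply,
    Nat.factorial_succ]
  congr 1
  push_cast
  field_simp

/-- The exponential of a derivation respects brackets: after division by n!, the binomial
coefficients in the Leibniz rule for Aⁿ become those of a product of two exponential series. -/
lemma expPolynomial_lie {I : Type*} [LieRing I] [LieAlgebra ℂ I] {ρ : I →ₗ[ℂ] S}
    (hρ : ∀ x y : I, ρ ⁅x, y⁆ = ρ x * ρ y - ρ y * ρ x) (A : LieDerivation ℂ I I) {N : ℕ}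
    (hA : (A : Module.End ℂ I) ^ N = 0) (x y : I) :
    expPolynomial ρ A N ⁅x, y⁆ = expPolynomial ρ A N x * expPolynomial ρ A N y -
      expPolynomial ρ A N y * expPolynomial ρ A N x := by
  ext n
  have h : ∀ k : ℕ, (k.factorial : ℂ) ≠ 0 := fun k => by exact_mod_cast k.factorial_ne_zero
  rw [Polynomial.coeff_sub, Polynomial.coeff_mul, Polynomial.coeff_mul,
    -- The swap makes both products use the same pair: A ^ i on x and A ^ j on y.
    ← Finset.Nat.sum_antidiagonal_swap (n := n)
      (f := fun p => (expPolynomial ρ A N y).coeff p.1 * (expPolynomial ρ A N x).coeff p.2),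
    ← Finset.sum_sub_distrib]
  have h1 : ∀ (k : ℕ) (z : I), ((A : Module.End ℂ I) ^ k) z = A^[k] z := fun k z => by
    rw [Module.End.pow_apply]; rfl
  simp only [coeff_expPolynomial ρ hA, h1, LieDerivation.iterate_apply_lie, map_sum, Prod.fst_swap,
    Prod.snd_swap, Finset.smul_sum, map_nsmul, hρ]
  refine Finset.sum_congr rfl fun p hp => ?_
  obtain ⟨i, j⟩ := p
  obtain rfl : i + j = n := by simpa using hp
  simp only [smul_mul_smul_comm]
  rw [mul_comm ((j.factorial : ℂ)⁻¹), ← smul_sub, ← Nat.cast_smul_eq_nsmul ℂ, smul_smul]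
  congr 1
  have hi := h i
  have hj := h j
  have hij := h (i + j)
  have hc : ((i + j).choose i : ℂ) * i.factorial * j.factorial = (i + j).factorial := by
    rw [Nat.choose_symm_add]
    exact_mod_cast Nat.add_choose_mul_factorial_mul_factorial i j
  field_simp
  linear_combination hc

end ExpPolynomial

/-! ### Embedding nilpotent Lie algebras by canonical commutation relations -/

/-- If `a` commutes with the coefficients and `[a, b] = 1`, then `[a, p(b)] = p'(b)`. -/
lemma commutator_eval₂ {S R : Type*} [Ring S] [Ring R] (φ : S →+* R) {a b : R}
    (hab : a * b - b * a = 1) (ha : ∀ s, Commute a (φ s)) (hb : ∀ s, Commute (φ s) b)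
    (p : Polynomial S) :
    a * Polynomial.eval₂RingHom' φ b hb p - Polynomial.eval₂RingHom' φ b hb p * a =
      Polynomial.eval₂RingHom' φ b hb (Polynomial.derivative p) := by
  have hX : Polynomial.eval₂RingHom' φ b hb Polynomial.X = b := Polynomial.eval₂_X φ b
  have hC : ∀ s, Polynomial.eval₂RingHom' φ b hb (Polynomial.C s) = φ s :=
    fun s => Polynomial.eval₂_C φ b
  have hab' : a * b = b * a + 1 := by rw [← hab]; abel
  set Φ := Polynomial.eval₂RingHom' φ b hb
  induction p using Polynomial.induction_on with
  | C s => simp [hC, (ha s).eq]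
  | add p q hp hq =>
    rw [map_add, Polynomial.derivative_add, map_add, ← hp, ← hq]
    noncomm_ring
  | monomial n s ih =>
    rw [pow_succ, ← mul_assoc, Polynomial.derivative_mul, map_mul, map_add, map_mul, map_mul, ← ih,
      hX, Polynomial.derivative_X, mul_one, map_mul]
    simp only [mul_assoc, sub_mul, hab', mul_add, mul_one]
    abel

/-- A Lie algebra with a functional `f` vanishing on brackets and `f x = 1` embeds into an
algebra containing `[a, b] = 1` and, commuting with both, a copy of `ker f`, provided `ad x` is
nilpotent: `x` acts as `a = d/db` and `y ∈ ker f` as `exp (b ad x) y`. -/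
lemma exists_embedding_of_ideal_embedding {L R : Type*} [LieRing L] [LieAlgebra ℂ L]
    [LieRing.IsNilpotent L] [Ring R] [Nontrivial R] [Algebra ℂ R] (S : Subalgebra ℂ R) {a b : R}
    (hab : a * b - b * a = 1) (ha : ∀ s ∈ S, Commute a s) (hb : ∀ s ∈ S, Commute s b)
    (f : L →ₗ[ℂ] ℂ) (I : LieIdeal ℂ L) (hI : ∀ y, y ∈ I ↔ f y = 0) {x : L} (hx : f x = 1)
    (hf : ∀ y z : L, f ⁅y, z⁆ = 0)
    (ρ : I →ₗ[ℂ] S) (hρ : ∀ y z : I, ρ ⁅y, z⁆ = ρ y * ρ z - ρ z * ρ y)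
    (hinj : Function.Injective ρ) :
    ∃ σ : L →ₗ[ℂ] R, (∀ y z : L, σ ⁅y, z⁆ = σ y * σ z - σ z * σ y) ∧ Function.Injective σ ∧
      ∀ T : Subalgebra ℂ R, S ≤ T → a ∈ T → b ∈ T → ∀ y, σ y ∈ T := by
  have hnil : LieModule.IsNilpotent L I :=
    Function.Injective.lieModuleIsNilpotent (R := ℂ) (f := (LieHom.id : L →ₗ⁅ℂ⁆ L))
      (g := I.toSubmodule.subtype) (fun _ _ => rfl) Subtype.val_injective
  let A : LieDerivation ℂ I I :=
    { toLinearMap := LieModule.toEnd ℂ L I x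
      leibniz' := fun y z => by
        apply Subtype.ext
        simp only [LieModule.toEnd_apply_apply, LieSubmodule.coe_bracket, LieSubmodule.coe_sub,
          LieIdeal.coe_bracket_of_module, LieSubmodule.coe_bracket]
        rw [leibniz_lie, ← lie_skew (z : L) ⁅x, (y : L)⁆]
        abel }
  have hAx : ∀ y : I, ((A y : I) : L) = ⁅x, (y : L)⁆ := fun _ => rfl
  obtain ⟨N, hN⟩ := LieModule.isNilpotent_toEnd_of_isNilpotent ℂ L I x
  have hA : (A : Module.End ℂ I) ^ N = 0 := hN
  let Φ := Polynomial.eval₂RingHom' (S.val : S →+* R) b (fun s => hb s s.2)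
  let P := expPolynomial ρ (A : Module.End ℂ I) N
  have hΦsmul : ∀ (c : ℂ) p, Φ (c • p) = c • Φ p := by
    intro c p
    have h1 : c • p = Polynomial.C (algebraMap ℂ S c) * p := by
      rw [← Polynomial.smul_eq_C_mul, algebraMap_smul]
    rw [h1, map_mul, Algebra.smul_def]
    congr 1
    exact Polynomial.eval₂_C _ _
  let Φl : Polynomial S →ₗ[ℂ] R :=
    { toFun := Φ, map_add' := map_add Φ, map_smul' := hΦsmul }
  let τ : I →ₗ[ℂ] R := Φl ∘ₗ P
  have hτ : ∀ y, τ y = Φ (P y) := fun _ => rfl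
  have hτlie : ∀ y z, τ ⁅y, z⁆ = τ y * τ z - τ z * τ y := fun y z => by
    rw [hτ, hτ, hτ, ← map_mul Φ, ← map_mul Φ, ← map_sub Φ]
    exact congrArg Φ (expPolynomial_lie hρ A hA y z)
  have hτA : ∀ y, τ (A y) = a * τ y - τ y * a := fun y => by
    refine Eq.trans ?_ (commutator_eval₂ (S.val : S →+* R) hab (fun s => ha s s.2)
      (fun s => hb s s.2) (P y)).symm
    exact congrArg Φ (derivative_expPolynomial ρ hA y).symm
  have hτb : ∀ y, Commute (τ y) b := fun y => by
    have : Φ Polynomial.X = b := Polynomial.eval₂_X _ b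
    rw [hτ, ← this]
    exact (Polynomial.commute_X _).symm.map Φ
  have hτT : ∀ T : Subalgebra ℂ R, S ≤ T → b ∈ T → ∀ y, τ y ∈ T := fun T hS hbT y => by
    rw [hτ]
    change Polynomial.eval₂ _ _ _ ∈ T
    rw [Polynomial.eval₂_eq_sum]
    exact T.sum_mem fun n _ => T.mul_mem (hS (Subtype.prop _)) (T.pow_mem hbT n)
  -- a nonzero kernel would be `A`-stable, hence meet `ker A`, where `τ = ρ`
  have hτinj : ∀ y, τ y = 0 → y = 0 := by
    intro y hy
    have hk : ∀ k, τ ((A : Module.End ℂ I) ^ k • y) = 0 := by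
      intro k
      induction k with
      | zero => simpa using hy
      | succ k ih =>
        rw [pow_succ', mul_smul]
        change τ (A _) = 0
        rw [hτA, ih, mul_zero, zero_mul, sub_zero]
    by_contra hne
    have hex : ∃ k, (A : Module.End ℂ I) ^ k • y = 0 := ⟨N, by simp [hA]⟩
    classical
    obtain ⟨k, hk1⟩ : ∃ k, Nat.find hex = k + 1 :=
      Nat.exists_eq_succ_of_ne_zero fun h0 => hne (by simpa [h0] using Nat.find_spec hex)
    set w := (A : Module.End ℂ I) ^ k • y
    have hw : w ≠ 0 := Nat.find_min hex (by omega)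
    have hAw : (A : Module.End ℂ I) w = 0 := by
      have := Nat.find_spec hex
      rwa [hk1, pow_succ', mul_smul] at this
    have hPw : P w = Polynomial.C (ρ w) := by
      ext n
      rw [coeff_expPolynomial ρ hA, Polynomial.coeff_C]
      cases n with
      | zero => simp
      | succ n => simp [pow_succ, Module.End.mul_apply, hAw]
    have : τ w = ρ w := by
      rw [hτ, hPw]
      exact Polynomial.eval₂_C _ _
    rw [hk k] at this
    exact hw (hinj (by rw [map_zero]; exact Subtype.ext this.symm))
  let π : L →ₗ[ℂ] I := LinearMap.codRestrict I.toSubmodule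
    (LinearMap.id - f.smulRight x) (fun y => by
      change _ ∈ I
      rw [hI]
      simp [hx])
  have hπ : ∀ y, (π y : L) = y - f y • x := fun _ => rfl
  -- The bracket of L written as that of the semidirect product I ⋊ ℂx, with x acting by `A`.
  have hπlie : ∀ y z, π ⁅y, z⁆ = ⁅π y, π z⁆ + f y • A (π z) - f z • A (π y) := by
    intro y z
    apply Subtype.ext
    change ⁅y, z⁆ - f ⁅y, z⁆ • x = ⁅y - f y • x, z - f z • x⁆ + f y • ⁅x, z - f z • x⁆ -
      f z • ⁅x, y - f y • x⁆
    simp only [hf, sub_lie, lie_sub, smul_lie, lie_smul, lie_self]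
    rw [← lie_skew x y]
    module
  refine ⟨τ ∘ₗ π + f.smulRight a, ?_, ?_, ?_⟩
  · intro y z
    simp only [LinearMap.add_apply, LinearMap.comp_apply, LinearMap.smulRight_apply, hf, zero_smul,
      add_zero, hπlie, map_add, map_sub, map_smul, hτlie, hτA, mul_add, add_mul, smul_mul_assoc,
      mul_smul_comm, smul_sub, smul_add, smul_smul, mul_comm (f z) (f y)]
    abel
  · rw [injective_iff_map_eq_zero]
    intro y hy
    simp only [LinearMap.add_apply, LinearMap.comp_apply, LinearMap.smulRight_apply] at hy
    -- Since τ(I) commutes with b, the commutator with b reads off the coefficient of x.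
    have h1 : (τ (π y) + f y • a) * b - b * (τ (π y) + f y • a) = f y • (1 : R) := by
      rw [← hab, add_mul, mul_add, (hτb _).eq, smul_mul_assoc, mul_smul_comm, smul_sub]
      abel
    rw [hy, zero_mul, mul_zero, sub_zero] at h1
    have hfy : f y = 0 := (smul_eq_zero.1 h1.symm).resolve_right one_ne_zero
    rw [hfy, zero_smul, add_zero] at hy
    have := hπ y
    rw [hτinj _ hy, hfy, zero_smul, sub_zero] at this
    exact this.symm
  · intro T hS haT hbT y
    exact T.add_mem (hτT T hS hbT _) (T.smul_mem haT _)

/-- A nontrivial nilpotent Lie algebra has a nonzero functional vanishing on all brackets. -/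
lemma exists_functional_vanishing_on_brackets (L : Type*) [LieRing L] [LieAlgebra ℂ L]
    [Nontrivial L] [LieRing.IsNilpotent L] :
    ∃ f : L →ₗ[ℂ] ℂ, (∃ x, f x = 1) ∧ ∀ y z : L, f ⁅y, z⁆ = 0 := by
  have hlt := LieAlgebra.derivedSeries_lt_top_of_solvable ℂ L
  have hlt' : (LieAlgebra.derivedSeries ℂ L 1).toSubmodule < ⊤ := by
    rw [lt_top_iff_ne_top] at hlt ⊢
    exact fun h => hlt (by rwa [LieSubmodule.toSubmodule_eq_top] at h)
  obtain ⟨f, hf0, hf⟩ := Submodule.exists_le_ker_of_lt_top _ hlt'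
  obtain ⟨x, hx⟩ : ∃ x, f x ≠ 0 := by
    by_contra! h
    exact hf0 (LinearMap.ext h)
  refine ⟨f, ⟨(f x)⁻¹ • x, by simp [hx]⟩, fun y z => hf ?_⟩
  change ⁅y, z⁆ ∈ LieAlgebra.derivedSeries ℂ L 1
  rw [LieAlgebra.derivedSeries_def, LieAlgebra.derivedSeriesOfIdeal_succ,
    LieAlgebra.derivedSeriesOfIdeal_zero]
  exact LieSubmodule.lie_mem_lie (LieSubmodule.mem_top _) (LieSubmodule.mem_top _)

/-- A nilpotent Lie algebra of dimension at most `m` embeds into every nontrivial algebra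
generated by `m` pairs satisfying the canonical commutation relations. -/
theorem exists_embedding_of_ccr {R : Type*} [Ring R] [Nontrivial R] [Algebra ℂ R] (m : ℕ)
    (a b : Fin m → R) (hab : ∀ j k, a j * b k - b k * a j = if j = k then 1 else 0)
    (haa : ∀ j k, a j * a k = a k * a j) (hbb : ∀ j k, b j * b k = b k * b j)
    (L : Type*) [LieRing L] [LieAlgebra ℂ L] [FiniteDimensional ℂ L] [LieRing.IsNilpotent L]
    (hL : Module.finrank ℂ L ≤ m) :
    ∃ ρ : L →ₗ[ℂ] R, (∀ x y : L, ρ ⁅x, y⁆ = ρ x * ρ y - ρ y * ρ x) ∧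
      Function.Injective ρ ∧ ∀ x, ρ x ∈ Algebra.adjoin ℂ (Set.range a ∪ Set.range b) := by
  induction m generalizing L with
  | zero =>
    have : Subsingleton L := Module.finrank_zero_iff.1 (Nat.le_zero.1 hL)
    exact ⟨0, by simp, Function.injective_of_subsingleton _, fun x => Subalgebra.zero_mem _⟩
  | succ m ih =>
    rcases subsingleton_or_nontrivial L with hs | hn
    · exact ⟨0, by simp, Function.injective_of_subsingleton _, fun x => Subalgebra.zero_mem _⟩
    obtain ⟨f, ⟨x, hx⟩, hf⟩ := exists_functional_vanishing_on_brackets L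
    let I : LieIdeal ℂ L := { LinearMap.ker f with lie_mem := fun {y z} _ => hf y z }
    have hI : ∀ y, y ∈ I ↔ f y = 0 := fun y => Iff.rfl
    have hlt : Module.finrank ℂ I < Module.finrank ℂ L := by
      refine Submodule.finrank_lt (s := I.toSubmodule) fun htop => ?_
      have : x ∈ I.toSubmodule := htop ▸ Submodule.mem_top
      exact one_ne_zero (hx.symm.trans ((hI x).1 this))
    have hnilI : LieRing.IsNilpotent I :=
      Function.Injective.lieAlgebra_isNilpotent (R := ℂ) (f := I.incl) I.incl_injective
    -- The first m pairs serve the ideal; the last pair, which commutes with them, is kept for x.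
    obtain ⟨ρ, hρ, hinj, hmem⟩ := ih (a ∘ Fin.castSucc) (b ∘ Fin.castSucc)
      (fun j k => by simpa using hab j.castSucc k.castSucc) (fun j k => haa _ _)
      (fun j k => hbb _ _) I (by omega)
    set S := Algebra.adjoin ℂ (Set.range (a ∘ Fin.castSucc) ∪ Set.range (b ∘ Fin.castSucc))
    have hSc : ∀ c : R, (∀ j : Fin m, Commute c (a j.castSucc)) →
        (∀ j : Fin m, Commute c (b j.castSucc)) → ∀ s ∈ S, Commute c s := by
      intro c h1 h2 s hs
      refine Algebra.adjoin_le (S := Subalgebra.centralizer ℂ {c}) ?_ hs c rfl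
      rintro _ (⟨j, rfl⟩ | ⟨j, rfl⟩) _ rfl
      · exact h1 j
      · exact h2 j
    obtain ⟨σ, hσ, hσinj, hσT⟩ := exists_embedding_of_ideal_embedding S
      (a := a (Fin.last m)) (b := b (Fin.last m)) (by simpa using hab (Fin.last m) (Fin.last m))
      (hSc _ (fun j => haa _ _) fun j => sub_eq_zero.1 (by
        rw [hab, if_neg (Fin.castSucc_lt_last j).ne']))
      (fun s hs => (hSc _ (fun j => (sub_eq_zero.1 (by
        rw [hab, if_neg (Fin.castSucc_lt_last j).ne]) : a j.castSucc * b (Fin.last m) =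
          b (Fin.last m) * a j.castSucc).symm) (fun j => hbb _ _) s hs).symm)
      f I hI hx hf (LinearMap.codRestrict (Subalgebra.toSubmodule S) ρ hmem)
      (fun y z => Subtype.ext (hρ y z)) (fun y z h => hinj (congrArg Subtype.val h))
    refine ⟨σ, hσ, hσinj, hσT _ (Algebra.adjoin_mono ?_) ?_ ?_⟩
    · exact Set.union_subset_union (Set.range_comp_subset_range _ _) (Set.range_comp_subset_range _ _)
    · exact Algebra.subset_adjoin (Or.inl ⟨_, rfl⟩)
    · exact Algebra.subset_adjoin (Or.inr ⟨_, rfl⟩)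

/-! ### The bosonic Fock representation -/

/-- The Hilbert space `ℓ²(ℕᵐ)`. -/
abbrev FockSpace (m : ℕ) : Type := lp (fun _ : Fin m → ℕ => ℂ) 2

section Fock

variable {m : ℕ}

/-- The standard Hilbert basis of `ℓ²(ℕᵐ)`. -/
noncomputable def fockHilbertBasis (m : ℕ) : HilbertBasis (Fin m → ℕ) ℂ (FockSpace m) :=
  HilbertBasis.ofRepr (LinearIsometryEquiv.refl ℂ _)

/-- The squared norm `∏ nⱼ!` of a monomial for the Fischer inner product. -/
def multiFactorial (n : Fin m → ℕ) : ℕ := ∏ j, (n j).factorial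

lemma multiFactorial_pos (n : Fin m → ℕ) : 0 < multiFactorial n :=
  Finset.prod_pos fun j _ => (n j).factorial_pos

lemma multiFactorial_add_single (n : Fin m → ℕ) (j : Fin m) :
    multiFactorial (n + Pi.single j 1) = (n j + 1) * multiFactorial n := by
  simp only [multiFactorial]
  rw [← Finset.mul_prod_erase _ _ (Finset.mem_univ j),
    ← Finset.mul_prod_erase _ (fun k => (n k).factorial) (Finset.mem_univ j)]
  rw [Finset.prod_congr rfl (g := fun k => (n k).factorial)]
  · simp [Nat.factorial_succ, mul_assoc]
  · intro k hk
    simp [Finset.ne_of_mem_erase hk]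

/-- The embedding of polynomials in `ℓ²` which is isometric for the Fischer inner product: the
monomial `xⁿ` is sent to `√(n!) eₙ`. -/
noncomputable def fischerEmbedding (m : ℕ) : MvPolynomial (Fin m) ℂ →ₗ[ℂ] FockSpace m :=
  (MvPolynomial.basisMonomials (Fin m) ℂ).constr ℂ fun n =>
    ((Real.sqrt (multiFactorial n) : ℝ) : ℂ) • fockHilbertBasis m n

lemma fischerEmbedding_monomial (n : Fin m →₀ ℕ) (c : ℂ) :
    fischerEmbedding m (MvPolynomial.monomial n c) =
      (c * (Real.sqrt (multiFactorial n) : ℝ)) • fockHilbertBasis m n := by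
  have h : MvPolynomial.monomial n c = c • MvPolynomial.basisMonomials (Fin m) ℂ n := by
    simp [MvPolynomial.smul_monomial]
  rw [h, map_smul, fischerEmbedding, Module.Basis.constr_basis, smul_smul]

lemma inner_fischerEmbedding_monomial (n k : Fin m →₀ ℕ) (c d : ℂ) :
    inner ℂ (fischerEmbedding m (MvPolynomial.monomial n c))
      (fischerEmbedding m (MvPolynomial.monomial k d)) =
      if n = k then (starRingEnd ℂ) c * d * multiFactorial n else 0 := by
  have hinj : ((n : Fin m → ℕ) = k) ↔ n = k := DFunLike.coe_fn_eq
  rw [fischerEmbedding_monomial, fischerEmbedding_monomial, inner_smul_left, inner_smul_right,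
    orthonormal_iff_ite.1 (fockHilbertBasis m).orthonormal]
  simp only [hinj]
  split_ifs with h
  · subst h
    have hs : ((Real.sqrt (multiFactorial n) : ℝ) : ℂ) * (Real.sqrt (multiFactorial n) : ℝ) =
        multiFactorial n := by
      rw [← Complex.ofReal_mul, Real.mul_self_sqrt (Nat.cast_nonneg _), Complex.ofReal_natCast]
    rw [map_mul, Complex.conj_ofReal, ← hs]
    ring
  · simp

/-- Pairing with a monomial recovers the corresponding coefficient up to the nonzero factor n!. -/
lemma fischerEmbedding_injective (m : ℕ) : Function.Injective (fischerEmbedding m) := by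
  rw [injective_iff_map_eq_zero]
  intro p hp
  ext n
  have h : ∀ q : MvPolynomial (Fin m) ℂ,
      inner ℂ (fischerEmbedding m (MvPolynomial.monomial n 1)) (fischerEmbedding m q) =
        q.coeff n * multiFactorial n := by
    intro q
    induction q using MvPolynomial.induction_on' with
    | monomial k d =>
      rw [inner_fischerEmbedding_monomial, MvPolynomial.coeff_monomial]
      simp only [eq_comm (a := n)]
      split_ifs <;> simp_all
    | add q r hq hr => rw [map_add, inner_add_right, hq, hr, MvPolynomial.coeff_add, add_mul]
  have hn := h p
  rw [hp, inner_zero_right] at hn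
  have : (multiFactorial n : ℂ) ≠ 0 := by exact_mod_cast (multiFactorial_pos n).ne'
  simpa [this] using hn.symm

/-- Multiplication by xⱼ and ∂/∂xⱼ are adjoint because the weights satisfy (n + eⱼ)! = (nⱼ + 1) n!.
-/
lemma inner_X_mul (j : Fin m) (p q : MvPolynomial (Fin m) ℂ) :
    inner ℂ (fischerEmbedding m (MvPolynomial.X j * p)) (fischerEmbedding m q) =
      inner ℂ (fischerEmbedding m p) (fischerEmbedding m (MvPolynomial.pderiv j q)) := by
  induction p using MvPolynomial.induction_on' with
  | add p p' hp hp' => rw [mul_add, map_add, inner_add_left, hp, hp', map_add, inner_add_left]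
  | monomial n c =>
    induction q using MvPolynomial.induction_on' with
    | add q q' hq hq' => rw [map_add, inner_add_right, hq, hq', map_add, map_add, inner_add_right]
    | monomial k d =>
      rw [MvPolynomial.pderiv_monomial, mul_comm, MvPolynomial.X, MvPolynomial.monomial_mul,
        mul_one, inner_fischerEmbedding_monomial, inner_fischerEmbedding_monomial]
      by_cases hk : k j = 0
      -- Here the derivative vanishes, and k cannot be n + eⱼ.
      · rw [hk, if_neg]
        · simp
        · rintro rfl
          simp at hk
      · have hle : Finsupp.single j 1 ≤ k := by
          rw [Finsupp.single_le_iff]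
          omega
        have hiff : n + Finsupp.single j 1 = k ↔ n = k - Finsupp.single j 1 :=
          (eq_tsub_iff_add_eq_of_le hle).symm
        simp only [hiff]
        split_ifs with h
        · rw [← hiff] at h
          subst h
          have := multiFactorial_add_single (n : Fin m → ℕ) j
          rw [← Finsupp.single_eq_pi_single, ← Finsupp.coe_add] at this
          rw [this]
          simp only [Finsupp.add_apply, Finsupp.single_eq_same]
          push_cast
          ring
        · rfl

/-- The commutator of two derivations is a derivation, and this one kills every variable. -/
lemma pderiv_comm (j k : Fin m) (p : MvPolynomial (Fin m) ℂ) :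
    MvPolynomial.pderiv j (MvPolynomial.pderiv k p) =
      MvPolynomial.pderiv k (MvPolynomial.pderiv j p) := by
  have h : ⁅MvPolynomial.pderiv (R := ℂ) j, MvPolynomial.pderiv (R := ℂ) k⁆ = 0 := by
    refine MvPolynomial.derivation_ext fun i => ?_
    rw [Derivation.commutator_apply, MvPolynomial.pderiv_X, MvPolynomial.pderiv_X]
    by_cases hj : j = i <;> by_cases hk : k = i <;> simp [hj, hk]
  have := DFunLike.congr_fun h p
  rwa [Derivation.commutator_apply, Derivation.zero_apply, sub_eq_zero] at this

/-- The lowering operator `∂/∂xⱼ`. -/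
noncomputable def loweringOperator (j : Fin m) : Module.End ℂ (MvPolynomial (Fin m) ℂ) :=
  (MvPolynomial.pderiv j).toLinearMap

/-- The raising operator, multiplication by `xⱼ`. -/
noncomputable def raisingOperator (j : Fin m) : Module.End ℂ (MvPolynomial (Fin m) ℂ) :=
  Algebra.lmul ℂ _ (MvPolynomial.X j)

lemma loweringOperator_apply (j : Fin m) (p : MvPolynomial (Fin m) ℂ) :
    loweringOperator j p = MvPolynomial.pderiv j p := rfl

lemma raisingOperator_apply (j : Fin m) (p : MvPolynomial (Fin m) ℂ) :
    raisingOperator j p = MvPolynomial.X j * p := rfl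

lemma loweringOperator_mul_raisingOperator (j k : Fin m) :
    loweringOperator j * raisingOperator k - raisingOperator k * loweringOperator j =
      if j = k then 1 else 0 := by
  refine LinearMap.ext fun p => ?_
  rw [LinearMap.sub_apply, Module.End.mul_apply, Module.End.mul_apply, raisingOperator_apply,
    raisingOperator_apply, loweringOperator_apply, loweringOperator_apply, MvPolynomial.pderiv_mul,
    add_sub_cancel_right, MvPolynomial.pderiv_X]
  by_cases hjk : j = k
  · subst hjk
    simp
  · simp [hjk]

lemma loweringOperator_comm (j k : Fin m) :
    loweringOperator j * loweringOperator k = loweringOperator k * loweringOperator j :=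
  LinearMap.ext fun p => pderiv_comm j k p

lemma raisingOperator_comm (j k : Fin m) :
    raisingOperator j * raisingOperator k = raisingOperator k * raisingOperator j := by
  rw [raisingOperator, raisingOperator, ← map_mul, mul_comm, map_mul]

/-- Polynomials, as a subspace of `ℓ²`. -/
noncomputable def fischerEquiv (m : ℕ) :
    MvPolynomial (Fin m) ℂ ≃ₗ[ℂ] LinearMap.range (fischerEmbedding m) :=
  LinearEquiv.ofInjective _ (fischerEmbedding_injective m)

lemma fischerEquiv_conj_apply (T : Module.End ℂ (MvPolynomial (Fin m) ℂ))
    (p : MvPolynomial (Fin m) ℂ) :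
    (fischerEquiv m).conjAlgEquiv ℂ T (fischerEquiv m p) = fischerEquiv m (T p) := by
  rw [LinearEquiv.conjAlgEquiv_apply, LinearMap.comp_apply, LinearMap.comp_apply,
    LinearEquiv.coe_coe, LinearEquiv.coe_coe, LinearEquiv.symm_apply_apply]

lemma dense_range_fischerEmbedding (m : ℕ) :
    Dense (LinearMap.range (fischerEmbedding m) : Set (FockSpace m)) := by
  rw [Submodule.dense_iff_topologicalClosure_eq_top, eq_top_iff,
    ← (fockHilbertBasis m).dense_span]
  refine Submodule.topologicalClosure_mono (Submodule.span_le.2 ?_)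
  rintro _ ⟨n, rfl⟩
  have hn : ((Real.sqrt (multiFactorial n) : ℝ) : ℂ) ≠ 0 := by
    exact_mod_cast (Real.sqrt_pos.2 (by exact_mod_cast multiFactorial_pos n)).ne'
  refine ⟨MvPolynomial.monomial (Finsupp.equivFunOnFinite.symm n)
    ((Real.sqrt (multiFactorial n) : ℝ) : ℂ)⁻¹, ?_⟩
  rw [fischerEmbedding_monomial, Finsupp.coe_equivFunOnFinite_symm, inv_mul_cancel₀ hn,
    one_smul]

lemma inner_raisingOperator (j : Fin m) (f g : LinearMap.range (fischerEmbedding m)) :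
    inner ℂ (((fischerEquiv m).conjAlgEquiv ℂ (raisingOperator j) f :
        LinearMap.range (fischerEmbedding m)) : FockSpace m) (g : FockSpace m) =
      inner ℂ (f : FockSpace m) (((fischerEquiv m).conjAlgEquiv ℂ (loweringOperator j) g :
        LinearMap.range (fischerEmbedding m)) : FockSpace m) := by
  obtain ⟨p, rfl⟩ := (fischerEquiv m).surjective f
  obtain ⟨q, rfl⟩ := (fischerEquiv m).surjective g
  rw [fischerEquiv_conj_apply, fischerEquiv_conj_apply]
  exact inner_X_mul j p q

/-- The bosonic Fock representation: `aⱼ = ∂/∂xⱼ` and `bⱼ = xⱼ` on polynomials. -/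
noncomputable def fockFamily (m : ℕ) : PseudoBosonicFamily m (FockSpace m) where
  D := LinearMap.range (fischerEmbedding m)
  dense_D := dense_range_fischerEmbedding m
  a j := (fischerEquiv m).conjAlgEquiv ℂ (loweringOperator j)
  b j := (fischerEquiv m).conjAlgEquiv ℂ (raisingOperator j)
  aAdj j := (fischerEquiv m).conjAlgEquiv ℂ (raisingOperator j)
  bAdj j := (fischerEquiv m).conjAlgEquiv ℂ (loweringOperator j)
  inner_aAdj := inner_raisingOperator
  inner_bAdj j f g := by
    rw [← inner_conj_symm, ← inner_raisingOperator, inner_conj_symm]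
  comm_a_b j k := by
    rw [← map_mul, ← map_mul, ← map_sub, loweringOperator_mul_raisingOperator]
    split_ifs <;> simp
  comm_a_a j k := by rw [← map_mul, ← map_mul, loweringOperator_comm]
  comm_b_b j k := by rw [← map_mul, ← map_mul, raisingOperator_comm]

/-- The normalization 1/√(n!) of the excited states cancels the factor √(n!) by which the embedding
scales xⁿ. -/
lemma excited_raisingOperator (n : Fin m → ℕ) :
    ((PseudoBosonicFamily.excited
        (fun j => (fischerEquiv m).conjAlgEquiv ℂ (raisingOperator j)) (fischerEquiv m 1) n :
        LinearMap.range (fischerEmbedding m)) : FockSpace m) = fockHilbertBasis m n := by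
  let Θ : MvPolynomial (Fin m) ℂ →ₐ[ℂ] Module.End ℂ (LinearMap.range (fischerEmbedding m)) :=
    ((fischerEquiv m).conjAlgEquiv ℂ).toAlgHom.comp (Algebra.lmul ℂ _)
  have hΘ : ∀ p q, Θ p (fischerEquiv m q) = fischerEquiv m (p * q) := fun p q => by
    exact fischerEquiv_conj_apply (Algebra.lmul ℂ _ p) q
  have hprod : (List.ofFn fun j => (fischerEquiv m).conjAlgEquiv ℂ (raisingOperator j) ^ n j).prod =
      Θ (MvPolynomial.monomial (Finsupp.equivFunOnFinite.symm n) 1) := by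
    have h1 : (MvPolynomial.monomial (Finsupp.equivFunOnFinite.symm n) (1 : ℂ)) =
        (List.ofFn fun j => MvPolynomial.X j ^ n j).prod := by
      rw [List.prod_ofFn, MvPolynomial.monomial_eq, map_one, one_mul]
      exact Finsupp.prod_fintype _ _ fun _ => pow_zero _
    rw [h1, map_list_prod, List.map_ofFn]
    congr 2
    funext j
    exact (map_pow Θ _ _).symm
  have hn : ((Real.sqrt (multiFactorial n) : ℝ) : ℂ) ≠ 0 := by
    exact_mod_cast (Real.sqrt_pos.2 (by exact_mod_cast multiFactorial_pos n)).ne'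
  rw [PseudoBosonicFamily.excited, hprod, hΘ, mul_one]
  change ((Real.sqrt (multiFactorial n) : ℝ) : ℂ)⁻¹ • fischerEmbedding m _ = _
  rw [fischerEmbedding_monomial, smul_smul, Finsupp.coe_equivFunOnFinite_symm, one_mul,
    inv_mul_cancel₀ hn, one_smul]

theorem fockFamily_hasRieszVacua (m : ℕ) : (fockFamily m).HasRieszVacua := by
  have hvac : ∀ j : Fin m,
      (fischerEquiv m).conjAlgEquiv ℂ (loweringOperator j) (fischerEquiv m 1) = 0 := fun j => by
    rw [fischerEquiv_conj_apply, loweringOperator_apply, MvPolynomial.pderiv_one, map_zero]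
  have hR : IsRieszBasis (fun n : Fin m → ℕ => ((PseudoBosonicFamily.excited
        (fun j => (fischerEquiv m).conjAlgEquiv ℂ (raisingOperator j)) (fischerEquiv m 1) n :
        LinearMap.range (fischerEmbedding m)) : FockSpace m)) :=
    -- The basis is already orthonormal, so the identity serves as the bounded invertible operator.
    ⟨fockHilbertBasis m, ContinuousLinearEquiv.refl ℂ _, excited_raisingOperator⟩
  refine ⟨fischerEquiv m 1, fischerEquiv m 1, hvac, hvac, ?_, hR, hR⟩
  have h := inner_fischerEmbedding_monomial (m := m) 0 0 1 1
  rw [if_pos rfl] at h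
  exact h.trans (by simp [multiFactorial])

end Fock

theorem fockFamily_realizes (m : ℕ) (L : Type*) [LieRing L] [LieAlgebra ℂ L]
    [FiniteDimensional ℂ L] [LieRing.IsNilpotent L] (hL : Module.finrank ℂ L ≤ m) :
    (fockFamily m).Realizes L := by
  have : Nontrivial (fockFamily m).D := (fischerEquiv m).symm.toEquiv.nontrivial
  exact exists_embedding_of_ccr m (fockFamily m).a (fockFamily m).b (fockFamily m).comm_a_b
    (fockFamily m).comm_a_a (fockFamily m).comm_b_b L hL

/-! ### Central extension and conclusion -/

/-- A nontrivial nilpotent Lie algebra is a central extension of a quotient by a one-dimensional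
ideal. -/
lemma exists_central_extension_finrank_one (L : Type*) [LieRing L] [LieAlgebra ℂ L] [Nontrivial L]
    [LieRing.IsNilpotent L] :
    ∃ (I : LieIdeal ℂ L) (π : L →ₗ⁅ℂ⁆ L ⧸ I), Module.finrank ℂ I = 1 ∧ Function.Surjective π ∧
      IsCentralExtension I.incl π := by
  have := LieAlgebra.non_trivial_center_of_isNilpotent (R := ℂ) (L := L)
  obtain ⟨⟨z, hz⟩, hz0⟩ := exists_ne (0 : LieAlgebra.center ℂ L)
  have hz0' : z ≠ 0 := fun h => hz0 (Subtype.ext h)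
  -- Any nonzero central vector will do: its span is an ideal, as all brackets with it vanish.
  have hspan : ∀ y ∈ Submodule.span ℂ {z}, y ∈ LieAlgebra.center ℂ L := fun y hy => by
    obtain ⟨c, rfl⟩ := Submodule.mem_span_singleton.1 hy
    exact (LieAlgebra.center ℂ L).smul_mem c hz
  have hbr : ∀ (x y : L), y ∈ Submodule.span ℂ {z} → ⁅x, y⁆ = 0 := fun x y hy =>
    (LieModule.mem_maxTrivSubmodule ℂ L L y).1 (hspan y hy) x
  let I : LieIdeal ℂ L :=
    { Submodule.span ℂ {z} with
      lie_mem := fun {x y} hy => by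
        change ⁅x, y⁆ ∈ Submodule.span ℂ {z}
        rw [hbr x y hy]
        exact Submodule.zero_mem _ }
  let π : L →ₗ⁅ℂ⁆ L ⧸ I :=
    { (LieSubmodule.Quotient.mk' I : L →ₗ[ℂ] L ⧸ I) with
      map_lie' := fun {x y} => LieSubmodule.Quotient.mk_bracket I x y }
  have hπ : Function.Surjective π := LieSubmodule.Quotient.surjective_mk' I
  have hker : ∀ y, π y = 0 ↔ y ∈ I := fun y => LieSubmodule.Quotient.mk_eq_zero I
  refine ⟨I, π, finrank_span_singleton hz0', hπ, ⟨⟨fun x y => Subtype.ext (hbr x y y.2)⟩,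
    ⟨LieIdeal.ker_incl I, (LieHom.range_eq_top π).2 hπ, ?_⟩, fun x => hspan x x.2⟩⟩
  ext y
  rw [LieIdeal.incl_range]
  exact (hker y).symm

theorem corollary3p3 (L : Type*) [LieRing L] [LieAlgebra ℂ L] [FiniteDimensional ℂ L]
    [Nontrivial L] [LieRing.IsNilpotent L] (hL : Module.finrank ℂ L ≤ 5) :
    RealizedByPseudoBosonicCentralExtension L := by
  obtain ⟨I, π, hI, hπ, hext⟩ := exists_central_extension_finrank_one L
  have hnil : LieRing.IsNilpotent (L ⧸ I) := hπ.lieAlgebra_isNilpotent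
  have hfin : FiniteDimensional ℂ (L ⧸ I) := Module.Finite.of_surjective (π : L →ₗ[ℂ] L ⧸ I) hπ
  have hle : Module.finrank ℂ (L ⧸ I) ≤ 5 :=
    (LinearMap.finrank_le_finrank_of_surjective (f := (π : L →ₗ[ℂ] L ⧸ I)) hπ).trans hL
  exact ⟨5, FockSpace 5, inferInstance, inferInstance, inferInstance, fockFamily 5, by norm_num,
    fockFamily_hasRieszVacua 5,
    ⟨I, L ⧸ I, inferInstance, inferInstance, inferInstance, inferInstance, I.incl, π, hI, hext,
      fockFamily_realizes 5 _ hle⟩,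
    fockFamily_realizes 5 L hL⟩
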